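/- Let $\mathbb{N}=\{1,2,3,\ldots\}$. For $A\subset\mathbb{N}$ let \[ \mathsf{d}^*(A)=\limsup_{N-M\to\infty}\frac{|A\cap\{M+1,M+2,\ldots,N\}|}{N-M} \] denote its upper Banach density. For every $A\subset\mathbb{N}$ with $\mathsf{d}^*(A)>0$ there exist infinite sets $B\subset\mathbb{N}$ and $C\subset A$ such that \[ \{b^2+c : b\in B,\ c\in C,\ b<c\}\subset A. \] -/

import Mathlib

/-- The filter on pairs `(M, N)` of natural numbers that expresses `N - M → ∞`
(the difference is taken in `ℤ`, so that it does not truncate). -/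
noncomputable def windowFilter : Filter (ℕ × ℕ) :=
  Filter.comap (fun p : ℕ × ℕ => (p.2 : ℤ) - (p.1 : ℤ)) Filter.atTop

/-- The upper Banach density
`d*(A) = limsup_{N - M → ∞} |A ∩ {M + 1, …, N}| / (N - M)`. The ratio lies in `[0, 1]` as soon as
`M < N`, and `windowFilter` is a proper filter, so this is an honest `limsup` of real numbers. -/
noncomputable def upperBanachDensity (A : Set ℕ) : ℝ :=
  Filter.limsup
    (fun p : ℕ × ℕ => ((A ∩ Set.Ioc p.1 p.2).ncard : ℝ) / ((p.2 : ℝ) - (p.1 : ℝ)))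
    windowFilter

/-! Put S n = A ∩ (A - n²). An ultrafilter limit of averages over long windows gives a
shift-invariant mean m with m(A) > 0. Furstenberg–Sárközy (`exists_ge_measure_inter_shift_sq`) then
gives m(S n) ≥ m(A)²/4 for infinitely many n. Its proof lives in the Hilbert space of m: the
indicator of A splits into its projection on the closure of the periodic vectors, almost fixed by
U^(n²) when n is a multiple of a suitable q, and an orthogonal part controlled by van der Corput's
trick.

Among infinitely many sets of measure bounded below, one meets infinitely many others in measure
bounded below (`exists_infinite_inter`). Iterating this yields b₁ < c₁ < b₂ < c₂ < ⋯ with c_j in S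
b₁ ∩ ⋯ ∩ S b_j. The condition b < c leaves only pairs with i ≤ j, so this suffices. -/

open Filter Topology Finset

/-! ### Square recurrence for isometries of a Hilbert space -/

section Hilbert

variable {H : Type*} [NormedAddCommGroup H] [InnerProductSpace ℝ H]

theorem LinearIsometry.pow_apply_add (V : H →ₗᵢ[ℝ] H) (m n : ℕ) (x : H) :
    (V ^ (m + n)) x = (V ^ m) ((V ^ n) x) := by
  rw [pow_add]; rfl

theorem LinearIsometry.pow_apply_eq_self {V : H →ₗᵢ[ℝ] H} {x : H} (hx : V x = x) (n : ℕ) :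
    (V ^ n) x = x := by
  induction n with
  | zero => rfl
  | succ n ih => rw [V.pow_apply_add, pow_one, hx, ih]

theorem LinearIsometry.coe_pow_eq_iterate (V : H →ₗᵢ[ℝ] H) (n : ℕ) (x : H) :
    (V ^ n) x = V^[n] x := by
  induction n with
  | zero => rfl
  | succ n ih => rw [add_comm, V.pow_apply_add, pow_one, ih, add_comm, Function.iterate_succ_apply']

/-- If `h` is orthogonal to the fixed vectors of an isometry `V`, then the Cesàro averages of
`⟪V ^ n w, h⟫` tend to zero. -/
theorem LinearIsometry.tendsto_average_inner_of_orthogonal_fixed [CompleteSpace H]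
    (V : H →ₗᵢ[ℝ] H) {h : H} (hh : ∀ x, V x = x → inner ℝ x h = 0) (w : H) :
    Tendsto (fun N : ℕ => (N : ℝ)⁻¹ * ∑ n ∈ range N, inner ℝ ((V ^ n) w) h) atTop (𝓝 0) := by
  have key := ContinuousLinearMap.tendsto_birkhoffAverage_orthogonalProjection (𝕜 := ℝ)
    V.toContinuousLinearMap V.norm_toContinuousLinearMap_le w
  have h2 := key.inner (𝕜 := ℝ) (tendsto_const_nhds (x := h))
  rw [hh _ ((V.toContinuousLinearMap.eqLocus
    (1 : H →L[ℝ] H)).orthogonalProjectionOnto w).2] at h2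
  refine h2.congr fun N => ?_
  simp [birkhoffAverage, birkhoffSum, inner_smul_left, sum_inner, V.coe_pow_eq_iterate]

theorem norm_sum_sq_eq {ι : Type*} (s : Finset ι) (u : ι → H) :
    ‖∑ i ∈ s, u i‖ ^ 2 = ∑ i ∈ s, ∑ j ∈ s, inner ℝ (u i) (u j) := by
  rw [← real_inner_self_eq_norm_sq, sum_inner]
  exact sum_congr rfl fun i _ => inner_sum _ _ _

/-- Van der Corput's computation: the squared norms of `K` consecutive terms of `V ^ n² h` are on
average `K ‖h‖²`, if `h` is orthogonal to all periodic vectors. -/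
theorem LinearIsometry.tendsto_average_norm_sq_sum_squares [CompleteSpace H] (V : H →ₗᵢ[ℝ] H)
    {h : H} (hh : ∀ r : ℕ, 0 < r → ∀ x, (V ^ r) x = x → inner ℝ x h = 0) (K : ℕ) :
    Tendsto (fun N : ℕ => (N : ℝ)⁻¹ * ∑ n ∈ range N,
      ‖∑ i ∈ range K, (V ^ (n + i) ^ 2) h‖ ^ 2) atTop (𝓝 (K * ‖h‖ ^ 2)) := by
  have lt_case : ∀ i j : ℕ, j < i → Tendsto (fun N : ℕ => (N : ℝ)⁻¹ * ∑ n ∈ range N,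
      inner ℝ ((V ^ (n + i) ^ 2) h) ((V ^ (n + j) ^ 2) h)) atTop (𝓝 0) := by
    intro i j hij
    obtain ⟨d, rfl⟩ := Nat.exists_eq_add_of_lt hij
    have := (V ^ (2 * (d + 1))).tendsto_average_inner_of_orthogonal_fixed
      (hh _ (by positivity)) ((V ^ ((d + 1) * (2 * j + d + 1))) h)
    refine this.congr fun N => ?_
    congr 1
    refine sum_congr rfl fun n _ => ?_
    -- The difference of the two squares is linear in n, so the correlation is a linear ergodic
    -- average for V^(2(d+1)).
    have e : (n + (j + d + 1)) ^ 2
        = (n + j) ^ 2 + (2 * (d + 1) * n + (d + 1) * (2 * j + d + 1)) := by ring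
    rw [e, V.pow_apply_add, LinearIsometry.inner_map_map, V.pow_apply_add,
      pow_mul V (2 * (d + 1)) n]
  have pair : ∀ i j : ℕ, Tendsto (fun N : ℕ => (N : ℝ)⁻¹ * ∑ n ∈ range N,
      inner ℝ ((V ^ (n + i) ^ 2) h) ((V ^ (n + j) ^ 2) h)) atTop
      (𝓝 (if i = j then ‖h‖ ^ 2 else 0)) := by
    intro i j
    rcases lt_trichotomy j i with hij | rfl | hij
    · rw [if_neg hij.ne']; exact lt_case i j hij
    · rw [if_pos rfl]
      refine tendsto_const_nhds.congr' ?_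
      filter_upwards [eventually_gt_atTop 0] with N hN
      have : (N : ℝ) ≠ 0 := by positivity
      simp
      field_simp
    · rw [if_neg hij.ne]
      simpa only [real_inner_comm] using lt_case j i hij
  have := tendsto_finsetSum (range K) fun i _ =>
    tendsto_finsetSum (range K) fun j _ => pair i j
  have lim : ∑ i ∈ range K, ∑ j ∈ range K, (if i = j then ‖h‖ ^ 2 else 0) = K * ‖h‖ ^ 2 := by
    simp +contextual [sum_ite_eq]
  rw [lim] at this
  refine this.congr fun N => ?_
  simp only [norm_sum_sq_eq, ← mul_sum]
  congr 1
  rw [sum_comm (s := range N)]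
  exact sum_congr rfl fun i _ => sum_comm

/-- The first J terms do not affect the limit, so terms above c from J on would force L ≥ c. -/
theorem exists_ge_le_of_tendsto_average {F : ℕ → ℝ} {L c : ℝ} (hF : ∀ n, 0 ≤ F n)
    (h : Tendsto (fun N : ℕ => (N : ℝ)⁻¹ * ∑ n ∈ range N, F n) atTop (𝓝 L)) (hc : L < c)
    (J : ℕ) : ∃ n ≥ J, F n ≤ c := by
  by_contra! hcon
  have hc0 : Tendsto (fun N : ℕ => c - (J * c) * (N : ℝ)⁻¹) atTop (𝓝 (c - (J * c) * 0)) :=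
    tendsto_const_nhds.sub (tendsto_const_nhds.mul tendsto_inv_atTop_nhds_zero_nat)
  have : c - (J * c) * 0 ≤ L := by
    refine le_of_tendsto_of_tendsto hc0 h ?_
    filter_upwards [eventually_ge_atTop J, eventually_gt_atTop 0] with N hN hN0
    have hNr : (0 : ℝ) < N := by positivity
    have h1 : ∑ n ∈ Ico J N, c ≤ ∑ n ∈ range N, F n := by
      refine (sum_le_sum fun n hn => (hcon n (mem_Ico.1 hn).1).le).trans ?_
      exact sum_le_sum_of_subset_of_nonneg (fun n hn => by simp at hn ⊢; omega)
        fun n _ _ => hF n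
    rw [sum_const, Nat.card_Ico, nsmul_eq_mul, Nat.cast_sub hN] at h1
    calc c - (J * c) * (N : ℝ)⁻¹ = (N : ℝ)⁻¹ * ((N - J) * c) := by field_simp
      _ ≤ _ := by gcongr
  linarith

/-- If all late products were below -η, every late sum of K consecutive terms would have norm of
order K; van der Corput's computation gives one of order √K. -/
theorem LinearIsometry.exists_ge_inner_pow_sq_of_orthogonal_periodic [CompleteSpace H]
    (V : H →ₗᵢ[ℝ] H) {h : H} (hh : ∀ r : ℕ, 0 < r → ∀ x, (V ^ r) x = x → inner ℝ x h = 0)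
    (f : H) {η : ℝ} (hη : 0 < η) (J : ℕ) :
    ∃ j ≥ J, -η ≤ inner ℝ ((V ^ j ^ 2) h) f := by
  by_contra! hcon
  obtain ⟨K, hK⟩ := exists_nat_gt (max 1 (‖f‖ ^ 2 * (‖h‖ ^ 2 + 1) / η ^ 2))
  have hK1 : (1 : ℝ) < K := (le_max_left _ _).trans_lt hK
  have hK2 := (le_max_right _ _).trans_lt hK
  rw [div_lt_iff₀ (by positivity)] at hK2
  obtain ⟨n, hn, hle⟩ := exists_ge_le_of_tendsto_average (fun n => by positivity)
    (V.tendsto_average_norm_sq_sum_squares hh K) (lt_add_one _) J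
  set S := ∑ i ∈ range K, (V ^ (n + i) ^ 2) h with hS
  have h1 : inner ℝ S f ≤ -(K * η) := by
    rw [hS, sum_inner]
    calc _ ≤ ∑ i ∈ range K, -η := sum_le_sum fun i _ => (hcon (n + i) (by omega)).le
      _ = _ := by simp
  have h2 : K * η ≤ ‖S‖ * ‖f‖ := by
    have := abs_real_inner_le_norm S f
    have := neg_abs_le (inner ℝ S f)
    linarith
  have h3 : (K * η) ^ 2 ≤ (K * ‖h‖ ^ 2 + 1) * ‖f‖ ^ 2 := by
    calc (K * η) ^ 2 ≤ (‖S‖ * ‖f‖) ^ 2 := by gcongr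
      _ = ‖S‖ ^ 2 * ‖f‖ ^ 2 := by ring
      _ ≤ _ := by gcongr
  have h4 : (K * ‖h‖ ^ 2 + 1) * ‖f‖ ^ 2 ≤ K * (‖f‖ ^ 2 * (‖h‖ ^ 2 + 1)) := by
    nlinarith [sq_nonneg ‖f‖]
  nlinarith

/-- The submodule of vectors fixed by some positive power of `U`. -/
def LinearIsometry.periodicVectors (U : H →ₗᵢ[ℝ] H) : Submodule ℝ H where
  carrier := {x | ∃ q : ℕ, 0 < q ∧ (U ^ q) x = x}
  zero_mem' := ⟨1, one_pos, map_zero _⟩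
  add_mem' := by
    rintro x y ⟨p, hp, hx⟩ ⟨q, hq, hy⟩
    refine ⟨p * q, Nat.mul_pos hp hq, ?_⟩
    have h1 : (U ^ (p * q)) x = x := by rw [pow_mul]; exact LinearIsometry.pow_apply_eq_self hx q
    have h2 : (U ^ (p * q)) y = y := by
      rw [mul_comm, pow_mul]; exact LinearIsometry.pow_apply_eq_self hy p
    rw [map_add, h1, h2]
  smul_mem' := by
    rintro c x ⟨q, hq, hx⟩
    exact ⟨q, hq, by rw [map_smul, hx]⟩

/-- Furstenberg–Sárközy recurrence in a Hilbert space. -/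
theorem LinearIsometry.exists_ge_inner_pow_sq [CompleteSpace H] (U : H →ₗᵢ[ℝ] H) {e f : H}
    (he : U e = e) (he1 : ‖e‖ = 1) {a : ℝ} (ha : 0 < a) (hfe : a ≤ inner ℝ f e) :
    ∀ J : ℕ, ∃ n ≥ J, a ^ 2 / 4 ≤ inner ℝ ((U ^ n ^ 2) f) f := by
  intro J
  set P := U.periodicVectors.topologicalClosure with hP
  have : CompleteSpace P := U.periodicVectors.isClosed_topologicalClosure.completeSpace_coe
  have hsub : U.periodicVectors ≤ P := Submodule.le_topologicalClosure _
  set g : H := P.starProjection f with hg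
  have hgP : g ∈ P := by simp [hg]
  have horth : ∀ x ∈ P, inner ℝ x (f - g) = 0 := fun x hx =>
    (Submodule.mem_orthogonal P _).1 (P.sub_starProjection_mem_orthogonal f) x hx
  have heP : e ∈ P := hsub ⟨1, one_pos, by rw [pow_one, he]⟩
  have hga : a ≤ ‖g‖ := by
    have h1 := horth e heP
    rw [inner_sub_right, real_inner_comm, sub_eq_zero] at h1
    have h2 := real_inner_le_norm e g
    rw [he1, one_mul] at h2
    linarith
  have hgf : inner ℝ g f = ‖g‖ ^ 2 := by
    have := horth g hgP
    rw [inner_sub_right, real_inner_self_eq_norm_sq] at this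
    linarith
  -- Budget: ‖g‖² ≥ a², replacing g by a periodic g' costs 2ε‖f‖ ≤ a²/2, and the orthogonal part
  -- costs a²/4, leaving a²/4.
  set ε : ℝ := a ^ 2 / (4 * (‖f‖ + 1)) with hε
  have hεpos : 0 < ε := by positivity
  have hεf : 2 * ε * ‖f‖ ≤ a ^ 2 / 2 := by
    rw [hε]
    have : 2 * (a ^ 2 / (4 * (‖f‖ + 1))) * ‖f‖ = a ^ 2 / 2 * (‖f‖ / (‖f‖ + 1)) := by
      field_simp; ring
    rw [this]
    have : ‖f‖ / (‖f‖ + 1) ≤ 1 := by rw [div_le_one (by positivity)]; linarith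
    nlinarith [sq_nonneg a]
  obtain ⟨g', ⟨q, hq, hg'⟩, hgg'⟩ := Metric.mem_closure_iff.1
    (show g ∈ closure (U.periodicVectors : Set H) from hgP) ε hεpos
  rw [dist_eq_norm] at hgg'
  -- Taking n = q j makes n² a multiple of q, so U^(n²) fixes g', while U^(n²) = (U^(q²))^(j²).
  obtain ⟨j, hj, hjle⟩ := (U ^ q ^ 2).exists_ge_inner_pow_sq_of_orthogonal_periodic
    (h := f - g) (fun r hr x hx => horth x (hsub ⟨q ^ 2 * r, by positivity, by rwa [pow_mul]⟩))
    f (show (0 : ℝ) < a ^ 2 / 4 by positivity) J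
  refine ⟨q * j, hj.trans (Nat.le_mul_of_pos_left j hq), ?_⟩
  rw [← pow_mul, ← mul_pow] at hjle
  set W := U ^ (q * j) ^ 2 with hW
  have hWg' : W g' = g' := by
    rw [hW, show (q * j) ^ 2 = q * (q * j ^ 2) by ring, pow_mul]
    exact LinearIsometry.pow_apply_eq_self hg' _
  have hWg : ‖W g - g‖ ≤ 2 * ε := by
    have : W g - g = W (g - g') - (g - g') := by rw [map_sub, hWg']; abel
    rw [this]
    refine (norm_sub_le _ _).trans ?_
    rw [W.norm_map]; linarith
  have h1 : ‖g‖ ^ 2 - 2 * ε * ‖f‖ ≤ inner ℝ (W g) f := by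
    have h2 := neg_le_of_abs_le (abs_real_inner_le_norm (W g - g) f)
    rw [inner_sub_left, hgf] at h2
    have : ‖W g - g‖ * ‖f‖ ≤ 2 * ε * ‖f‖ := by gcongr
    linarith
  rw [map_sub, inner_sub_left] at hjle
  have : a ^ 2 ≤ ‖g‖ ^ 2 := by gcongr
  linarith

end Hilbert

/-- Furstenberg–Sárközy recurrence in a space with a positive semidefinite inner product. -/
theorem LinearIsometry.exists_ge_inner_pow_sq_of_seminormed {V : Type*} [SeminormedAddCommGroup V]
    [InnerProductSpace ℝ V] (U : V →ₗᵢ[ℝ] V) {e f : V} (he : U e = e) (he1 : ‖e‖ = 1) {a : ℝ}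
    (ha : 0 < a) (hfe : a ≤ inner ℝ f e) (J : ℕ) :
    ∃ n ≥ J, a ^ 2 / 4 ≤ inner ℝ (U^[n ^ 2] f) f := by
  let T : UniformSpace.Completion V →ₗᵢ[ℝ] UniformSpace.Completion V :=
    { toLinearMap := U.toContinuousLinearMap.completion
      norm_map' := fun x => by
        refine UniformSpace.Completion.induction_on x ?_ fun y => ?_
        · exact isClosed_eq U.toContinuousLinearMap.completion.continuous.norm continuous_norm
        · simp }
  have hT : ∀ x : V, T x = (U x : V) := fun x =>
    U.toContinuousLinearMap.completion_apply_coe x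
  have hTn : ∀ (n : ℕ) (x : V), (T ^ n) x = (U^[n] x : V) := by
    intro n
    induction n with
    | zero => intro x; rfl
    | succ n ih => intro x; rw [T.pow_apply_add, pow_one, hT, ih, Function.iterate_succ_apply]
  obtain ⟨n, hn, h⟩ := T.exists_ge_inner_pow_sq (e := (e : UniformSpace.Completion V))
    (f := (f : UniformSpace.Completion V)) (by rw [hT, he]) (by simpa using he1) ha
    (by simpa using hfe) J
  exact ⟨n, hn, by simpa [hTn] using h⟩

/-! ### Bounded sequences and invariant means -/

/-- The algebra of bounded real sequences. -/
def boundedSeq : Subalgebra ℝ (ℕ → ℝ) where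
  carrier := {f | ∃ C, ∀ n, |f n| ≤ C}
  mul_mem' := by
    rintro f g ⟨C, hC⟩ ⟨D, hD⟩
    exact ⟨C * D, fun n => by
      rw [Pi.mul_apply, abs_mul]
      exact mul_le_mul (hC n) (hD n) (abs_nonneg _) ((abs_nonneg _).trans (hC n))⟩
  add_mem' := by
    rintro f g ⟨C, hC⟩ ⟨D, hD⟩
    exact ⟨C + D, fun n => (abs_add_le _ _).trans (add_le_add (hC n) (hD n))⟩
  algebraMap_mem' := fun r => ⟨|r|, fun n => le_of_eq (by simp)⟩

namespace boundedSeq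

/-- The shift `f ↦ f (· + 1)`. -/
def shift : boundedSeq →ₗ[ℝ] boundedSeq where
  toFun f := ⟨fun n => f.1 (n + 1), f.2.imp fun _ hC n => hC (n + 1)⟩
  map_add' _ _ := rfl
  map_smul' _ _ := rfl

theorem shift_iterate_apply (k : ℕ) (f : boundedSeq) (n : ℕ) :
    (shift^[k] f).1 n = f.1 (n + k) := by
  induction k generalizing f with
  | zero => rfl
  | succ k ih =>
    rw [Function.iterate_succ_apply, ih]
    exact congrArg f.1 (by ring)

/-- The indicator function of a set. -/
noncomputable def ind (S : Set ℕ) : boundedSeq :=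
  ⟨S.indicator 1, 1, fun n => by by_cases h : n ∈ S <;> simp [h]⟩

theorem ind_mul_ind (S T : Set ℕ) : ind S * ind T = ind (S ∩ T) :=
  Subtype.ext (Set.inter_indicator_one (M₀ := ℝ)).symm

theorem shift_iterate_ind (k : ℕ) (S : Set ℕ) : shift^[k] (ind S) = ind {n | n + k ∈ S} := by
  refine Subtype.ext (funext fun n => ?_)
  rw [shift_iterate_apply]
  rfl

end boundedSeq

/-- A shift-invariant finitely additive probability measure on `ℕ`, as a linear functional on
bounded sequences. -/
structure InvariantMean where
  /-- The underlying functional. -/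
  toLinearMap : boundedSeq →ₗ[ℝ] ℝ
  nonneg : ∀ f : boundedSeq, (∀ n, 0 ≤ f.1 n) → 0 ≤ toLinearMap f
  map_one : toLinearMap 1 = 1
  map_shift : ∀ f, toLinearMap (boundedSeq.shift f) = toLinearMap f

namespace InvariantMean

open boundedSeq

/-- The measure of a set. -/
noncomputable def measure (m : InvariantMean) (S : Set ℕ) : ℝ := m.toLinearMap (ind S)

theorem mono (m : InvariantMean) {f g : boundedSeq} (h : ∀ n, f.1 n ≤ g.1 n) :
    m.toLinearMap f ≤ m.toLinearMap g := by
  have := m.nonneg (g - f) fun n => sub_nonneg.2 (h n)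
  rwa [map_sub, sub_nonneg] at this

/-- Furstenberg–Sárközy for a finitely additive invariant measure. -/
theorem exists_ge_measure_inter_shift_sq (m : InvariantMean) {A : Set ℕ} (hA : 0 < m.measure A)
    (J : ℕ) : ∃ n ≥ J, m.measure A ^ 2 / 4 ≤ m.measure {x | x + n ^ 2 ∈ A ∧ x ∈ A} := by
  -- The form m(f g) is only semidefinite; invariance of m makes the shift an isometry, with 1 as a
  -- fixed unit vector.
  let c : PreInnerProductSpace.Core ℝ boundedSeq :=
    { inner := fun f g => m.toLinearMap (f * g)
      conj_inner_symm := fun f g => by simp [mul_comm]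
      re_inner_nonneg := fun f => m.nonneg _ fun n => mul_self_nonneg (f.1 n)
      add_left := fun f g h => by rw [add_mul, map_add]
      smul_left := fun f g r => by simp }
  let i1 : SeminormedAddCommGroup boundedSeq :=
    InnerProductSpace.Core.toSeminormedAddCommGroup (c := c)
  let i2 : InnerProductSpace ℝ boundedSeq := InnerProductSpace.ofCore c
  have hinner : ∀ f g : boundedSeq, inner ℝ f g = m.toLinearMap (f * g) := fun f g => rfl
  let U : boundedSeq →ₗᵢ[ℝ] boundedSeq :=
    { toLinearMap := shift
      norm_map' := fun f => by
        rw [← sq_eq_sq₀ (norm_nonneg _) (norm_nonneg _), ← real_inner_self_eq_norm_sq,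
          ← real_inner_self_eq_norm_sq, hinner, hinner]
        exact m.map_shift (f * f) }
  have h1 : ‖(1 : boundedSeq)‖ = 1 := by
    rw [← sq_eq_sq₀ (norm_nonneg _) zero_le_one, ← real_inner_self_eq_norm_sq, hinner, mul_one,
      m.map_one, one_pow]
  obtain ⟨n, hn, h⟩ := U.exists_ge_inner_pow_sq_of_seminormed (e := 1) (f := ind A) rfl h1 hA
    (by rw [hinner, mul_one]; rfl) J
  refine ⟨n, hn, h.trans_eq ?_⟩
  rw [hinner]
  change m.toLinearMap (shift^[n ^ 2] (ind A) * ind A) = _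
  rw [shift_iterate_ind, ind_mul_ind]
  rfl

theorem measure_nonneg (m : InvariantMean) (S : Set ℕ) : 0 ≤ m.measure S :=
  m.nonneg _ fun n => Set.indicator_nonneg (fun _ _ => zero_le_one) n

/-- One step of Bonferroni's inequality, checked pointwise on indicators. -/
theorem measure_union_ge (m : InvariantMean) (S : ℕ → Set ℕ) (F : Finset ℕ) (i : ℕ) :
    m.measure (⋃ k ∈ F, S k) + m.measure (S i) - ∑ k ∈ F, m.measure (S k ∩ S i) ≤
      m.measure (⋃ k ∈ insert i F, S k) := by
  classical
  unfold measure
  rw [← map_add, ← map_sum, ← map_sub]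
  refine m.mono fun n => ?_
  have hcoe : (∑ k ∈ F, ind (S k ∩ S i)).1 n = ∑ k ∈ F, (S k ∩ S i).indicator 1 n := by
    rw [AddSubmonoidClass.coe_finsetSum, Finset.sum_apply]
    rfl
  change (⋃ k ∈ F, S k).indicator 1 n + (S i).indicator 1 n - (∑ k ∈ F, ind (S k ∩ S i)).1 n
    ≤ (⋃ k ∈ insert i F, S k).indicator (1 : ℕ → ℝ) n
  rw [hcoe, Finset.set_biUnion_insert]
  have hnn : ∀ k ∈ F, (0 : ℝ) ≤ (S k ∩ S i).indicator 1 n := fun k _ =>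
    Set.indicator_nonneg (fun _ _ => zero_le_one) n
  have hs := sum_nonneg hnn
  by_cases h1 : n ∈ ⋃ k ∈ F, S k <;> by_cases h2 : n ∈ S i
  · obtain ⟨k, hk, hnk⟩ := Set.mem_iUnion₂.1 h1
    have := single_le_sum hnn hk
    rw [Set.indicator_of_mem (Set.mem_inter hnk h2)] at this
    simp only [Set.indicator_of_mem h1, Set.indicator_of_mem h2,
      Set.indicator_of_mem (Set.mem_union_left _ h2), Pi.one_apply] at this ⊢
    linarith
  · simp only [Set.indicator_of_mem h1, Set.indicator_of_notMem h2,
      Set.indicator_of_mem (Set.mem_union_right _ h1), Pi.one_apply]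
    linarith
  · simp only [Set.indicator_of_notMem h1, Set.indicator_of_mem h2,
      Set.indicator_of_mem (Set.mem_union_left _ h2), Pi.one_apply]
    linarith
  · simp only [Set.indicator_of_notMem h1, Set.indicator_of_notMem h2,
      Set.indicator_of_notMem (fun h : n ∈ S i ∪ ⋃ k ∈ F, S k => h.elim h2 h1)]
    linarith

/-- Among infinitely many sets of measure at least `δ`, one meets infinitely many others in
measure bounded below. -/
theorem exists_infinite_inter (m : InvariantMean) (S : ℕ → Set ℕ) {δ : ℝ} (hδ : 0 < δ)
    {I : Set ℕ} (hI : I.Infinite) (hS : ∀ i ∈ I, δ ≤ m.measure (S i)) :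
    ∃ k ∈ I, ∃ δ' > 0, ∃ I' ⊆ I, I'.Infinite ∧ (∀ i ∈ I', δ' ≤ m.measure (S k ∩ S i)) := by
  by_contra! hcon
  have hfin : ∀ k ∈ I, ∀ ε > 0, {i ∈ I | ε ≤ m.measure (S k ∩ S i)}.Finite := by
    intro k hk ε hε
    by_contra hinf
    obtain ⟨i, hi, hlt⟩ := hcon k hk ε hε _ (Set.sep_subset _ _) hinf
    exact absurd hi.2 (not_le.2 hlt)
  obtain ⟨K, hK⟩ := exists_nat_gt (2 / δ)
  rw [div_lt_iff₀ hδ] at hK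
  have hK0 : (0 : ℝ) < K := by
    rcases Nat.eq_zero_or_pos K with rfl | h
    · norm_num at hK
    · exact_mod_cast h
  -- For K sets the overlaps cost at most K² ε = 1, while K δ > 2, so the union would have measure
  -- above 1.
  set ε : ℝ := 1 / K ^ 2 with hε
  have hεpos : 0 < ε := by positivity
  have hfam : ∀ r : ℕ, ∃ F : Finset ℕ, (F : Set ℕ) ⊆ I ∧ F.card = r ∧
      r * δ - r ^ 2 * ε ≤ m.measure (⋃ i ∈ F, S i) := by
    intro r
    induction r with
    | zero => exact ⟨∅, by simp, rfl, by
      simpa using m.measure_nonneg ∅⟩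
    | succ r ih =>
      obtain ⟨F, hFI, hFr, hF⟩ := ih
      -- Only finitely many indices lie in F or meet a member of F in measure at least ε.
      obtain ⟨i, hi, hiF⟩ := (hI.sdiff ((F.finite_toSet.biUnion fun k hk =>
        hfin k (hFI hk) ε hεpos).union F.finite_toSet)).nonempty
      simp only [Set.mem_union, Set.mem_iUnion, mem_coe, not_or, not_exists] at hiF
      refine ⟨insert i F, ?_, ?_, ?_⟩
      · rw [coe_insert]
        exact Set.insert_subset hi hFI
      · rw [card_insert_of_notMem hiF.2, hFr]
      · have hsum : ∑ k ∈ F, m.measure (S k ∩ S i) ≤ r * ε := by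
          rw [← hFr, ← nsmul_eq_mul]
          exact sum_le_card_nsmul _ _ _ fun k hk =>
            (not_le.1 fun hle => hiF.1 k hk ⟨hi, hle⟩).le
        have := m.measure_union_ge S F i
        have := hS i hi
        push_cast
        nlinarith
  obtain ⟨F, -, -, hF⟩ := hfam K
  have : m.measure (⋃ i ∈ F, S i) ≤ 1 := by
    rw [← m.map_one]
    exact m.mono fun n => Set.indicator_le_self' (by simp) n
  have : (K : ℝ) ^ 2 * ε = 1 := by rw [hε]; field_simp
  linarith

end InvariantMean

namespace InvariantMean

open boundedSeq

theorem map_shift_iterate (m : InvariantMean) (k : ℕ) (f : boundedSeq) :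
    m.toLinearMap (shift^[k] f) = m.toLinearMap f := by
  induction k generalizing f with
  | zero => rfl
  | succ k ih => rw [Function.iterate_succ_apply, ih, m.map_shift]

theorem measure_eq_zero_of_finite (m : InvariantMean) {S : Set ℕ} (hS : S.Finite) :
    m.measure S = 0 := by
  obtain ⟨k, hk⟩ := hS.bddAbove
  have : shift^[k + 1] (ind S) = 0 := by
    rw [shift_iterate_ind]
    refine Subtype.ext (funext fun n => Set.indicator_of_notMem (fun h => ?_) _)
    have := hk h
    omega
  rw [measure, ← m.map_shift_iterate (k + 1), this, map_zero]

end InvariantMean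

/-! ### From upper Banach density to an invariant mean -/

/-- The average of a sequence over the window `{M + 1, …, N}`. -/
noncomputable def windowMean (f : ℕ → ℝ) (p : ℕ × ℕ) : ℝ :=
  (∑ x ∈ Ioc p.1 p.2, f x) / ((p.2 : ℝ) - p.1)

theorem tendsto_window_length :
    Tendsto (fun p : ℕ × ℕ => (p.2 : ℝ) - p.1) windowFilter atTop := by
  have : Tendsto (fun p : ℕ × ℕ => ((p.2 : ℤ) - (p.1 : ℤ))) windowFilter atTop := tendsto_comap
  simpa [Function.comp_def] using (tendsto_intCast_atTop_atTop (R := ℝ)).comp this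

theorem eventually_window_lt : ∀ᶠ p : ℕ × ℕ in windowFilter, p.1 < p.2 := by
  filter_upwards [tendsto_window_length.eventually_gt_atTop 0] with p hp
  exact_mod_cast sub_pos.1 hp

instance : windowFilter.NeBot := by
  refine comap_neBot fun t ht => ?_
  obtain ⟨a, ha⟩ := mem_atTop_sets.1 ht
  exact ⟨(0, a.toNat), ha _ (by simp)⟩

theorem abs_windowMean_le {f : ℕ → ℝ} {C : ℝ} (hC : ∀ n, |f n| ≤ C) {p : ℕ × ℕ}
    (hp : p.1 < p.2) : |windowMean f p| ≤ C := by
  have hpos : (0 : ℝ) < (p.2 : ℝ) - p.1 := sub_pos.2 (by exact_mod_cast hp)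
  rw [windowMean, abs_div, abs_of_pos hpos, div_le_iff₀ hpos]
  refine (abs_sum_le_sum_abs _ _).trans ((sum_le_sum fun n _ => hC n).trans_eq ?_)
  rw [sum_const, Nat.card_Ioc, nsmul_eq_mul, Nat.cast_sub hp.le, mul_comm]

theorem windowMean_one {p : ℕ × ℕ} (hp : p.1 < p.2) : windowMean 1 p = 1 := by
  have hpos : (0 : ℝ) < (p.2 : ℝ) - p.1 := sub_pos.2 (by exact_mod_cast hp)
  simp [windowMean, Nat.cast_sub hp.le, hpos.ne']

theorem windowMean_add (f g : ℕ → ℝ) (p : ℕ × ℕ) :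
    windowMean (f + g) p = windowMean f p + windowMean g p := by
  simp [windowMean, sum_add_distrib, add_div]

theorem windowMean_smul (c : ℝ) (f : ℕ → ℝ) (p : ℕ × ℕ) :
    windowMean (c • f) p = c * windowMean f p := by
  simp [windowMean, ← mul_sum, mul_div_assoc]

/-- Telescoping leaves two boundary terms, negligible for long windows; hence the limit mean is
invariant. -/
theorem windowMean_shift_sub (f : ℕ → ℝ) {p : ℕ × ℕ} (hp : p.1 ≤ p.2) :
    windowMean (fun n => f (n + 1)) p - windowMean f p =
      (f (p.2 + 1) - f (p.1 + 1)) / ((p.2 : ℝ) - p.1) := by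
  rw [windowMean, windowMean, ← sub_div, ← sum_sub_distrib]
  congr 1
  obtain ⟨M, N⟩ := p
  induction N, hp using Nat.le_induction with
  | base => simp
  | succ N hMN ih => rw [sum_Ioc_succ_top (by simpa using hMN), ih]; ring

open Classical in
theorem windowMean_ind (A : Set ℕ) (p : ℕ × ℕ) : windowMean (boundedSeq.ind A).1 p =
    ((A ∩ Set.Ioc p.1 p.2).ncard : ℝ) / ((p.2 : ℝ) - (p.1 : ℝ)) := by
  have : A ∩ Set.Ioc p.1 p.2 = ((Ioc p.1 p.2).filter (· ∈ A) : Finset ℕ) := by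
    ext x; simp [and_comm]
  rw [windowMean, this, Set.ncard_coe_finset]
  congr 1
  simp [boundedSeq.ind, Set.indicator_apply]

/-- A set of positive upper Banach density has positive measure for some invariant mean. -/
theorem exists_invariantMean_measure_pos {A : Set ℕ} (hA : 0 < upperBanachDensity A) :
    ∃ m : InvariantMean, 0 < m.measure A := by
  set a := upperBanachDensity A / 2 with ha
  have hfreq : ∃ᶠ p in windowFilter, a < windowMean (boundedSeq.ind A).1 p := by
    simp only [windowMean_ind]
    refine frequently_lt_of_lt_limsup ?_ (show a < upperBanachDensity A by linarith)
    refine isCoboundedUnder_le_of_eventually_le (x := 0) _ ?_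
    filter_upwards [eventually_window_lt] with p hp
    have : (0 : ℝ) < (p.2 : ℝ) - p.1 := sub_pos.2 (by exact_mod_cast hp)
    positivity
  have hne := frequently_iff_neBot.1 hfreq
  -- An ultrafilter makes all bounded window means converge at once; restricting it to windows with
  -- mean above a keeps the limit at `ind A` positive.
  set G := Ultrafilter.of (windowFilter ⊓ 𝓟 {p | a < windowMean (boundedSeq.ind A).1 p})
  have hG : (G : Filter (ℕ × ℕ)) ≤ windowFilter := (Ultrafilter.of_le _).trans inf_le_left
  have hGa : ∀ᶠ p in (G : Filter (ℕ × ℕ)), a < windowMean (boundedSeq.ind A).1 p :=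
    (Ultrafilter.of_le _).trans inf_le_right (mem_principal_self _)
  have hlt : ∀ᶠ p in (G : Filter (ℕ × ℕ)), p.1 < p.2 := hG eventually_window_lt
  have hlim : ∀ f : boundedSeq, ∃ l, Tendsto (windowMean f.1) G (𝓝 l) := by
    intro f
    obtain ⟨C, hC⟩ := f.2
    obtain ⟨l, -, hl⟩ := (isCompact_Icc (a := -C) (b := C)).ultrafilter_le_nhds
      (G.map (windowMean f.1)) (le_principal_iff.2
        (hlt.mono fun p hp => abs_le.1 (abs_windowMean_le hC hp)))
    exact ⟨l, hl⟩
  choose L hL using hlim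
  refine ⟨⟨⟨⟨L, fun f g => ?_⟩, fun c f => ?_⟩, fun f hf => ?_, ?_, fun f => ?_⟩, ?_⟩
  · exact tendsto_nhds_unique (hL (f + g)) (((hL f).add (hL g)).congr fun p =>
      (windowMean_add f.1 g.1 p).symm)
  · exact tendsto_nhds_unique (hL (c • f)) (((hL f).const_mul c).congr fun p =>
      (windowMean_smul c f.1 p).symm)
  · refine ge_of_tendsto (hL f) ?_
    filter_upwards [hlt] with p hp
    exact div_nonneg (sum_nonneg fun n _ => hf n) (sub_nonneg.2 (by exact_mod_cast hp.le))
  · refine tendsto_nhds_unique (hL 1) (tendsto_const_nhds.congr' ?_)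
    filter_upwards [hlt] with p hp
    exact (windowMean_one hp).symm
  · obtain ⟨C, hC⟩ := f.2
    refine sub_eq_zero.1 (tendsto_nhds_unique ((hL (boundedSeq.shift f)).sub (hL f)) ?_)
    have hz : Tendsto (fun p : ℕ × ℕ => (C + C) / ((p.2 : ℝ) - p.1)) G (𝓝 0) :=
      tendsto_const_nhds.div_atTop (tendsto_window_length.mono_left hG)
    refine squeeze_zero_norm' ?_ hz
    filter_upwards [hlt] with p hp
    have hpos : (0 : ℝ) < (p.2 : ℝ) - p.1 := sub_pos.2 (by exact_mod_cast hp)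
    change ‖windowMean (fun n => f.1 (n + 1)) p - windowMean f.1 p‖ ≤ _
    rw [windowMean_shift_sub f.1 hp.le, Real.norm_eq_abs, abs_div, abs_of_pos hpos]
    gcongr
    exact (abs_sub _ _).trans (add_le_add (hC _) (hC _))
  · have : a ≤ L (boundedSeq.ind A) := ge_of_tendsto (hL _) (hGa.mono fun p hp => hp.le)
    exact (show 0 < a by positivity).trans_le this

/-! ### Construction of B and C -/

/-- If a property of sets of naturals passes from `E` to `E ∩ S k` for arbitrarily large `k`, and
only infinite sets have it, then there are interlaced sequences `b₁ < c₁ < b₂ < c₂ < ⋯` with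
`c j ∈ S (b i)` for `i ≤ j`. -/
theorem exists_interlaced_sequences (S : ℕ → Set ℕ) (P : Set ℕ → Prop) (h0 : P Set.univ)
    (hinf : ∀ E, P E → E.Infinite) (hstep : ∀ E, P E → ∀ l, ∃ k > l, P (E ∩ S k)) :
    ∃ b c : ℕ → ℕ, 0 < b 0 ∧ (∀ n, b n < c n) ∧ (∀ n, c n < b (n + 1)) ∧
      ∀ i j, i ≤ j → c j ∈ S (b i) := by
  let X := {s : Set ℕ × ℕ × ℕ // P s.1 ∧ s.2.2 ∈ s.1 ∧ s.2.1 < s.2.2}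
  have hX : ∀ s : X, ∃ t : X, s.1.2.2 < t.1.2.1 ∧ t.1.1 = s.1.1 ∩ S t.1.2.1 := by
    rintro ⟨⟨E, b, c⟩, hE, -, -⟩
    obtain ⟨k, hk, hPk⟩ := hstep E hE c
    obtain ⟨d, hd, hkd⟩ := (hinf _ hPk).exists_gt k
    exact ⟨⟨⟨E ∩ S k, k, d⟩, hPk, hd, hkd⟩, hk, rfl⟩
  choose f hf1 hf2 using hX
  -- The initial state is a dummy; the sequences are read from index 1 on, and its entry 1 only
  -- ensures b 0 > 0.
  let s : ℕ → X := fun n => f^[n] ⟨⟨Set.univ, 0, 1⟩, h0, trivial, one_pos⟩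
  have hs : ∀ n, s (n + 1) = f (s n) := fun n => Function.iterate_succ_apply' f n _
  have hanti : Antitone fun n => (s n).1.1 := antitone_nat_of_succ_le fun n => by
    rw [hs, hf2]; exact Set.inter_subset_left
  have hlt : ∀ n, (s n).1.2.2 < (s (n + 1)).1.2.1 := fun n => by rw [hs]; exact hf1 _
  refine ⟨fun n => (s (n + 1)).1.2.1, fun n => (s (n + 1)).1.2.2,
    (Nat.zero_le _).trans_lt (hlt 0), fun n => (s (n + 1)).2.2.2, fun n => hlt (n + 1), ?_⟩
  intro i j hij
  have h1 := hanti (Nat.succ_le_succ hij) (s (j + 1)).2.2.1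
  change (s (j + 1)).1.2.2 ∈ (s (i + 1)).1.1 at h1
  rw [hs i, hf2, ← hs i] at h1
  exact h1.2

theorem mainTheorem5 (A : Set ℕ) (hA_pos : ∀ a ∈ A, 0 < a) (hA : 0 < upperBanachDensity A) :
    ∃ B C : Set ℕ, (∀ b ∈ B, 0 < b) ∧ B.Infinite ∧ C ⊆ A ∧ C.Infinite ∧
      {n : ℕ | ∃ b ∈ B, ∃ c ∈ C, b < c ∧ n = b ^ 2 + c} ⊆ A := by
  obtain ⟨m, hm⟩ := exists_invariantMean_measure_pos hA
  let S : ℕ → Set ℕ := fun n => {x | x + n ^ 2 ∈ A ∧ x ∈ A}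
  -- The bound δ depends on E, since it may shrink at each intersection.
  let P : Set ℕ → Prop := fun E => ∃ δ > 0, ∃ I : Set ℕ, I.Infinite ∧
    ∀ i ∈ I, δ ≤ m.measure (E ∩ S i)
  obtain ⟨b, c, hb0, hbc, hcb, hS⟩ := exists_interlaced_sequences S P
    (by
      refine ⟨m.measure A ^ 2 / 4, by positivity, {n | m.measure A ^ 2 / 4 ≤ m.measure (S n)},
        Set.infinite_of_forall_exists_gt fun J => ?_, fun i hi => by rwa [Set.univ_inter]⟩
      obtain ⟨n, hn, h⟩ := m.exists_ge_measure_inter_shift_sq hm (J + 1)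
      exact ⟨n, h, hn⟩)
    (by
      rintro E ⟨δ, hδ, I, hI, h⟩ hfin
      obtain ⟨i, hi⟩ := hI.nonempty
      have := h i hi
      rw [m.measure_eq_zero_of_finite (hfin.subset Set.inter_subset_left)] at this
      linarith)
    (by
      rintro E ⟨δ, hδ, I, hI, h⟩ l
      obtain ⟨k, hk, δ', hδ', I', -, hI', h'⟩ := m.exists_infinite_inter (fun i => E ∩ S i) hδ
        (hI.sdiff (Set.finite_Iic l)) fun i hi => h i hi.1
      refine ⟨k, not_le.1 hk.2, δ', hδ', I', hI', fun i hi => ?_⟩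
      have := h' i hi
      rwa [← Set.inter_inter_distrib_left, ← Set.inter_assoc] at this)
  have hbmono : StrictMono b := strictMono_nat_of_lt_succ fun n => (hbc n).trans (hcb n)
  have hcmono : StrictMono c := strictMono_nat_of_lt_succ fun n => (hcb n).trans (hbc (n + 1))
  refine ⟨Set.range b, Set.range c, ?_, Set.infinite_range_of_injective hbmono.injective, ?_,
    Set.infinite_range_of_injective hcmono.injective, ?_⟩
  · rintro _ ⟨n, rfl⟩
    exact hb0.trans_le (hbmono.monotone n.zero_le)
  · rintro _ ⟨n, rfl⟩
    exact (hS n n le_rfl).2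
  · rintro _ ⟨_, ⟨i, rfl⟩, _, ⟨j, rfl⟩, hij, rfl⟩
    -- If j < i then c j < b (j + 1) ≤ b i, contrary to b i < c j.
    have : i ≤ j := by
      by_contra! h
      exact absurd (hbmono.monotone h) (not_le.2 (hij.trans (hcb j)))
    rw [add_comm]
    exact (hS i j this).1
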